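/- Let $F=\{p_k\}_{k\ge 0}$ be a probability distribution on $\{0,1,2,\dots\}$ with finite second moment, $\sum_k k^2p_k<\infty$. One run of the configuration model on $n$ vertices $v_1,\dots,v_n$ with stub distribution $F$ consists of drawing i.i.d. numbers $D_1,\dots,D_n$ with distribution $F$, attaching $D_i$ stubs to $v_i$, and joining the stubs in pairs completely at random (two uniformly chosen stubs are joined, then two uniformly chosen remaining ones, and so on), which gives a multigraph. If $\sum_i D_i$ is odd, one of the following two rules is applied, the same one throughout: (R1) one stub chosen uniformly at random is removed; or (R2) the $D_i$ are generated anew until their sum is even. Under (R2), $n$ is restricted to even values if $F$ is concentrated on the odd numbers. The repeated configuration model performs independent runs (with new $D_i$ in every run) until a run produces a simple graph, i.e. one without loops and multiple edges, and outputs that graph. Let $p_k^{(n)}$ be the probability that a uniformly chosen vertex of the output graph on $n$ vertices, chosen independently of the graph, has degree $k$, and let $N_j^{(n)}$ be the number of vertices of degree $j$ in the output graph. Then, under each of the rules (R1) and (R2), the procedure terminates almost surely for all sufficiently large $n$ (so that the quantities above are well defined), and as $n\to\infty$ (a) $p_k^{(n)}\to p_k$ for every $k\ge 0$, i.e. the degree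 distributions $F_n=\{p_k^{(n)}\}_{k\ge0}$ converge to $F$; (b) $N_j^{(n)}/n\to p_j$ in probability for every $j\ge 0$, i.e. the empirical degree distribution converges in probability to $F$. -/

import Mathlib

open MeasureTheory ProbabilityTheory Filter Topology

noncomputable section

namespace ConfigModel

/-- The stubs on the vertex set `Fin n`: `d i` of them are attached to the vertex `i`. -/
abbrev Stub {n : ℕ} (d : Fin n → ℕ) : Type := (i : Fin n) × Fin (d i)

/-- An enumeration of all stubs without repetition, i.e. an order in which the stubs are picked. -/
abbrev PickOrder {n : ℕ} (d : Fin n → ℕ) : Type := Fin (∑ i, d i) ≃ Stub d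

instance {n : ℕ} (d : Fin n → ℕ) : Nonempty (PickOrder d) := ⟨finSigmaFinEquiv.symm⟩

/-- The outcome of one run of the configuration model on `n` vertices: the numbers of stubs,
and the order in which the stubs are picked. -/
structure Run (n : ℕ) where
  stubs : Fin n → ℕ
  pick : PickOrder stubs

instance (n : ℕ) : MeasurableSpace (Run n) := ⊤

/-- `n` independent variables with distribution `F`. -/
def stubLaw (F : PMF ℕ) (n : ℕ) : PMF (Fin n → ℕ) :=
  (Measure.pi fun _ : Fin n => F.toMeasure).toPMF

/-- The law of one run: the numbers of stubs are i.i.d. with distribution `F`, and, given these,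
the stubs are picked one after the other, uniformly at random and without replacement. -/
def runLaw (F : PMF ℕ) (n : ℕ) : PMF (Run n) :=
  (stubLaw F n).bind fun d => (PMF.uniformOfFintype (PickOrder d)).map fun σ => ⟨d, σ⟩

namespace Run

variable {n : ℕ}

/-- The edges (loops and repetitions allowed): the first two stubs that are picked are joined,
then the next two, and so on. If the number of stubs is odd, the stub that is picked last (a
uniformly random one) is left over and thereby removed. -/
def edge (r : Run n) (t : Fin ((∑ i, r.stubs i) / 2)) : Sym2 (Fin n) :=
  s((r.pick ⟨2 * t, by omega⟩).1, (r.pick ⟨2 * t + 1, by omega⟩).1)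

/-- The multigraph produced by the run has neither loops nor multiple edges. -/
def IsSimple (r : Run n) : Prop :=
  (∀ t, ¬ (r.edge t).IsDiag) ∧ Function.Injective r.edge

/-- The graph on `Fin n` with the edges of the run. -/
def graph (r : Run n) : SimpleGraph (Fin n) := SimpleGraph.fromEdgeSet (Set.range r.edge)

end Run

/-- What is done if the total number of stubs is odd: either one stub chosen uniformly at random
is removed, or the numbers of stubs are generated again until their sum is even. -/
inductive ParityRule
  | removeStub
  | regenerate

/-- The runs with which the repeated configuration model stops. -/
def Accepted {n : ℕ} : ParityRule → Run n → Prop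
  | .removeStub, r => r.IsSimple
  | .regenerate, r => Even (∑ i, r.stubs i) ∧ r.IsSimple

/-- The law of an infinite sequence of independent runs on `n` vertices. -/
def runsLaw (F : PMF ℕ) (n : ℕ) : Measure (ℕ → Run n) :=
  Measure.infinitePi fun _ : ℕ => (runLaw F n).toMeasure

open Classical in
/-- The graph of the first accepted run (by convention the empty graph if there is none). -/
def output {n : ℕ} (rule : ParityRule) (ω : ℕ → Run n) : SimpleGraph (Fin n) :=
  if h : ∃ t, Accepted rule (ω t) then (ω (Nat.find h)).graph else ⊥

open Classical in
theorem measurable_output {n : ℕ} (rule : ParityRule) :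
    Measurable (output rule : (ℕ → Run n) → SimpleGraph (Fin n)) := by
  have hA : ∀ t, MeasurableSet {ω : ℕ → Run n | Accepted rule (ω t)} := fun t =>
    @measurable_pi_apply ℕ (fun _ => Run n) _ t {r | Accepted rule r} trivial
  have hG : ∀ t (S : Set (SimpleGraph (Fin n))),
      MeasurableSet {ω : ℕ → Run n | (ω t).graph ∈ S} := fun t S =>
    @measurable_pi_apply ℕ (fun _ => Run n) _ t {r | r.graph ∈ S} trivial
  intro S _
  have : output rule ⁻¹' S =
      (⋃ t, ({ω : ℕ → Run n | Accepted rule (ω t)} ∩ {ω | (ω t).graph ∈ S}) ∩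
        ⋂ s, ⋂ (_ : s < t), {ω | Accepted rule (ω s)}ᶜ) ∪
      ((⋂ t, {ω | Accepted rule (ω t)}ᶜ) ∩ {_ω | ⊥ ∈ S}) := by
    ext ω
    simp only [Set.mem_preimage, output, Set.mem_union, Set.mem_iUnion, Set.mem_inter_iff,
      Set.mem_setOf_eq, Set.mem_iInter, Set.mem_compl_iff]
    by_cases h : ∃ t, Accepted rule (ω t)
    · rw [dif_pos h]
      constructor
      · intro hS
        exact Or.inl ⟨Nat.find h, ⟨Nat.find_spec h, hS⟩, fun s hs => Nat.find_min h hs⟩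
      · rintro (⟨t, ⟨ht, hS⟩, hmin⟩ | ⟨hno, _⟩)
        · rwa [(Nat.find_eq_iff h).2 ⟨ht, fun s hs => hmin s hs⟩]
        · exact absurd h (by simpa using hno)
    · rw [dif_neg h]
      constructor
      · intro hS
        exact Or.inr ⟨fun t ht => h ⟨t, ht⟩, hS⟩
      · rintro (⟨t, ⟨ht, _⟩, _⟩ | ⟨_, hS⟩)
        · exact absurd ⟨t, ht⟩ h
        · exact hS
  rw [this]
  refine (MeasurableSet.iUnion fun t => ((hA t).inter (hG t S)).inter ?_).union ?_
  · exact MeasurableSet.iInter fun s => MeasurableSet.iInter fun _ => (hA s).compl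
  · exact (MeasurableSet.iInter fun t => (hA t).compl).inter (MeasurableSet.const _)

/-- The law of the random graph produced by the repeated configuration model. -/
def repeatedLaw (F : PMF ℕ) (rule : ParityRule) (n : ℕ) : Measure (SimpleGraph (Fin n)) :=
  (runsLaw F n).map (output rule)

open Classical in
/-- The number of vertices of degree `j`. -/
def numDegree {n : ℕ} (j : ℕ) (G : SimpleGraph (Fin n)) : ℕ :=
  (Finset.univ.filter fun v => G.degree v = j).card

open Classical in
/-- The probability that a vertex has degree `k`, where the graph has law `μ` and the vertex is
chosen uniformly at random, independently of the graph. -/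
def degreeProb {n : ℕ} (μ : Measure (SimpleGraph (Fin n))) (k : ℕ) : ℝ :=
  (μ.prod (uniformOn (Set.univ : Set (Fin n)))).real {x | x.1.degree x.2 = k}

/-- The numbers of vertices for which the parity rule makes sense: regenerating the numbers of
stubs never ends if `n` is odd and `F` is concentrated on the odd numbers. -/
def admissible (F : PMF ℕ) : ParityRule → Set ℕ
  | .removeStub => Set.univ
  | .regenerate => {n | ¬ (Odd n ∧ ∀ k ∈ F.support, Odd k)}

end ConfigModel

end

/-!
The empirical degree distribution of the output is that of the numbers of stubs of the first
accepted run, up to one vertex that may lose a stub (`abs_numDegree_graph_sub_le`), and that run has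
the law of a run conditioned on acceptance (`repeatedLaw_le`). For a single unconditioned run,
Hoeffding's inequality makes a deviation of the proportion of vertices with `j` stubs from `F j`
exponentially unlikely (`runLaw_abs_card_sub_le`). It therefore suffices that the probability of
acceptance decays more slowly than any exponential (`eventually_exp_le_runLaw_accepted`);
convergence of this probability to a positive limit is not needed.

For this lower bound fix `q < 1`. With probability at least of order `q ^ n`, all numbers of stubs
are bounded by a constant `K = K(q)`, the total number of stubs exceeds a prescribed constant, and
the parity is right (`le_runLaw_accepted`). Given such numbers of stubs, a run is simple with at
least polynomially small probability (`inv_pow_le_toMeasure_isSimple`). Indeed, the expected number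
of edges that are loops or belong to a multiple edge is at most `K + 4 K ^ 2`
(`sum_card_badEdges_le_mul_factorial`), so at least half of all pairings have at most
`B = 2 (K + 4 K ^ 2)` bad edges. If a pairing has between `1` and `B` of them, exchanging the
partners of two stubs reduces their number (`exists_swap_badEdges_ssubset`). As there are at most
`m ^ 2` such exchanges when there are `m` edges, the pairings with at most `k + 1` bad edges are at
most `m ^ 2` times as many as those with at most `k` (`card_fewBad_succ_le`), so that a proportion
of at least `1 / (2 m ^ (2 B))` has none.

The convergence of the degree distribution follows from that of the empirical one by taking
expectations (`degreeProb_eq_integral`).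
-/

namespace ConfigModel

/-! ### Switching away bad edges -/

section Switching

variable {ι α β V : Type*}

/-- The edges of a pairing. The stubs `β` are enumerated by `σ`, the stubs number `a t` and `b t`
are joined, and `π` maps a stub to the vertex that carries it. -/
def pairEdge (π : β → V) (a b : ι → α) (σ : α ≃ β) (t : ι) : Sym2 V :=
  s(π (σ (a t)), π (σ (b t)))

open Classical in
/-- The indices of the edges of a pairing that are loops or belong to a multiple edge. -/
noncomputable def badEdges [Fintype ι] (π : β → V) (a b : ι → α) (σ : α ≃ β) : Finset ι :=
  {t | (pairEdge π a b σ t).IsDiag ∨ ∃ s, s ≠ t ∧ pairEdge π a b σ s = pairEdge π a b σ t}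

theorem mem_badEdges [Fintype ι] {π : β → V} {a b : ι → α} {σ : α ≃ β} {t : ι} :
    t ∈ badEdges π a b σ ↔ (pairEdge π a b σ t).IsDiag ∨
      ∃ s, s ≠ t ∧ pairEdge π a b σ s = pairEdge π a b σ t := by
  simp [badEdges]

variable [Fintype ι] [DecidableEq α]

/-- If the edges `s(v, w)` and `s(y, x)` are replaced by `s(v, x)` and `s(y, w)`, and these are
neither loops nor present already, then the number of bad edges drops. -/
theorem badEdges_swap_ssubset {π : β → V} {a b : ι → α} (hab : Function.Injective (Sum.elim a b))
    {σ : α ≃ β} {s t : ι} (ht : t ∈ badEdges π a b σ) (hs : s ∉ badEdges π a b σ)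
    (hvx : π (σ (b s)) ≠ π (σ (a t)))
    (hvx' : ∀ r, pairEdge π a b σ r ≠ s(π (σ (a t)), π (σ (b s))))
    (hwy : π (σ (a s)) ≠ π (σ (b t)))
    (hwy' : ∀ r, pairEdge π a b σ r ≠ s(π (σ (b t)), π (σ (a s)))) :
    badEdges π a b ((Equiv.swap (b t) (b s)).trans σ) ⊂ badEdges π a b σ := by
  have hst : s ≠ t := by rintro rfl; exact hs ht
  have ha : ∀ r q, a r ≠ b q := fun r q h => by
    have := @hab (Sum.inl r) (Sum.inr q) h
    simp at this
  have hb : ∀ {r q}, r ≠ q → b r ≠ b q := fun {r q} hrq h => by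
    have := @hab (Sum.inr r) (Sum.inr q) h
    simp at this
    exact hrq this
  have er : ∀ r, r ≠ s → r ≠ t →
      pairEdge π a b ((Equiv.swap (b t) (b s)).trans σ) r = pairEdge π a b σ r := by
    intro r hrs hrt
    simp [pairEdge, Equiv.swap_apply_of_ne_of_ne (ha r t) (ha r s),
      Equiv.swap_apply_of_ne_of_ne (hb hrt) (hb hrs)]
  have et : pairEdge π a b ((Equiv.swap (b t) (b s)).trans σ) t =
      s(π (σ (a t)), π (σ (b s))) := by
    simp [pairEdge, Equiv.swap_apply_of_ne_of_ne (ha t t) (ha t s)]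
  have es : pairEdge π a b ((Equiv.swap (b t) (b s)).trans σ) s =
      s(π (σ (b t)), π (σ (a s))) := by
    simp [pairEdge, Equiv.swap_apply_of_ne_of_ne (ha s t) (ha s s), Sym2.eq_swap]
  have hne : s(π (σ (a t)), π (σ (b s))) ≠ s(π (σ (b t)), π (σ (a s))) := by
    intro h
    apply hs
    rw [mem_badEdges]
    rcases Sym2.eq_iff.1 h with ⟨h1, h2⟩ | ⟨h1, h2⟩
    · left
      simp [pairEdge, h2]
    · right
      exact ⟨t, hst.symm, by simp [pairEdge, h1, h2]⟩
  generalize hσ' : (Equiv.swap (b t) (b s)).trans σ = σ' at *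
  have htn : t ∉ badEdges π a b σ' := by
    rw [mem_badEdges, et]
    rintro (h | ⟨r, hrt, h⟩)
    · exact hvx (by simpa using h.symm)
    · by_cases hrs : r = s
      · subst hrs
        exact hne (by rw [← h, es])
      · exact hvx' r (by rw [← er r hrs hrt, h])
  have hsn : s ∉ badEdges π a b σ' := by
    rw [mem_badEdges, es]
    rintro (h | ⟨r, hrs, h⟩)
    · exact hwy (by simpa using h.symm)
    · by_cases hrt : r = t
      · subst hrt
        exact hne (by rw [← h, et])
      · exact hwy' r (by rw [← er r hrs hrt, h])
  refine Finset.ssubset_iff_subset_ne.2 ⟨fun r hr => ?_, fun h => htn (h ▸ ht)⟩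
  have hrs : r ≠ s := by rintro rfl; exact hsn hr
  have hrt : r ≠ t := by rintro rfl; exact htn hr
  rw [mem_badEdges, er r hrs hrt] at hr
  rw [mem_badEdges]
  rcases hr with h | ⟨q, hqr, h⟩
  · exact Or.inl h
  · right
    refine ⟨q, hqr, ?_⟩
    by_cases hqs : q = s
    · subst hqs
      exact (hwy' r (by rw [← h, es])).elim
    by_cases hqt : q = t
    · subst hqt
      exact (hvx' r (by rw [← h, et])).elim
    rw [← h, er q hqs hqt]

open Classical in
/-- A vertex, together with its neighbours in a pairing. -/
noncomputable def closedNbhd [Fintype V] (π : β → V) (a b : ι → α) (σ : α ≃ β) (v : V) :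
    Finset V :=
  {u | u = v ∨ ∃ r, pairEdge π a b σ r = s(v, u)}

variable [Fintype β] [DecidableEq V]

omit [DecidableEq α] in
theorem card_filter_mem_le {π : β → V} {K : ℕ} (hK : ∀ v, (Finset.univ.filter (π · = v)).card ≤ K)
    {f : ι → β} (hf : Function.Injective f) (N : Finset V) :
    (Finset.univ.filter fun s => π (f s) ∈ N).card ≤ K * N.card := by
  refine Finset.card_le_mul_card_image_of_maps_to (f := fun s => π (f s)) (fun s hs => by
    simpa using hs) K fun v _ => ?_
  refine le_trans (Finset.card_le_card_of_injOn f (fun s hs => ?_) hf.injOn) (hK v)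
  simp at hs ⊢
  exact hs.2

variable [Fintype V]

omit [DecidableEq α] in
theorem card_closedNbhd_le {π : β → V} {K : ℕ}
    (hK : ∀ v, (Finset.univ.filter (π · = v)).card ≤ K) {a b : ι → α}
    (ha : Function.Injective a) (hb : Function.Injective b) (σ : α ≃ β) (v : V) :
    (closedNbhd π a b σ v).card ≤ 1 + 2 * K := by
  classical
  have hsub : closedNbhd π a b σ v ⊆ {v} ∪
      ((Finset.univ.filter fun r => π (σ (a r)) ∈ ({v} : Finset V)).image (fun r => π (σ (b r))) ∪
      (Finset.univ.filter fun r => π (σ (b r)) ∈ ({v} : Finset V)).image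
        (fun r => π (σ (a r)))) := by
    intro u hu
    simp only [closedNbhd, Finset.mem_filter, Finset.mem_univ, true_and, pairEdge,
      Sym2.eq_iff] at hu
    simp only [Finset.mem_union, Finset.mem_image, Finset.mem_filter, Finset.mem_univ, true_and,
      Finset.mem_singleton]
    rcases hu with h | ⟨r, ⟨h1, h2⟩ | ⟨h1, h2⟩⟩
    · exact Or.inl h
    · exact Or.inr (Or.inl ⟨r, h1, h2⟩)
    · exact Or.inr (Or.inr ⟨r, h2, h1⟩)
  have h1 := card_filter_mem_le hK (σ.injective.comp ha) {v}
  have h2 := card_filter_mem_le hK (σ.injective.comp hb) {v}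
  simp only [Function.comp, Finset.card_singleton, mul_one] at h1 h2
  refine (Finset.card_le_card hsub).trans ((Finset.card_union_le _ _).trans ?_)
  rw [Finset.card_singleton]
  have := (Finset.card_union_le _ _).trans (add_le_add
    ((Finset.card_image_le (f := fun r => π (σ (b r)))).trans h1)
    ((Finset.card_image_le (f := fun r => π (σ (a r)))).trans h2))
  omega

/-- In a pairing with few bad edges and bounded degrees, a bad edge can be removed by exchanging
the partners of two stubs. -/
theorem exists_swap_badEdges_ssubset {π : β → V} {K : ℕ}
    (hK : ∀ v, (Finset.univ.filter (π · = v)).card ≤ K) {a b : ι → α}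
    (hab : Function.Injective (Sum.elim a b)) {σ : α ≃ β} {t : ι} (ht : t ∈ badEdges π a b σ)
    (hm : (badEdges π a b σ).card + 2 * (K * (1 + 2 * K)) < Fintype.card ι) :
    ∃ s, badEdges π a b ((Equiv.swap (b t) (b s)).trans σ) ⊂ badEdges π a b σ := by
  classical
  have ha : Function.Injective a := fun r q h => by
    simpa using @hab (Sum.inl r) (Sum.inl q) h
  have hb : Function.Injective b := fun r q h => by
    simpa using @hab (Sum.inr r) (Sum.inr q) h
  set v := π (σ (a t))
  set w := π (σ (b t))
  -- `s` must avoid the bad edges and those whose relevant end is `v` or `w` or a neighbour of it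
  set E2 := Finset.univ.filter fun s => π (σ (b s)) ∈ closedNbhd π a b σ v
  set E3 := Finset.univ.filter fun s => π (σ (a s)) ∈ closedNbhd π a b σ w
  have h2 : E2.card ≤ K * (1 + 2 * K) :=
    (card_filter_mem_le hK (σ.injective.comp hb) _).trans
      (Nat.mul_le_mul_left _ (card_closedNbhd_le hK ha hb σ v))
  have h3 : E3.card ≤ K * (1 + 2 * K) :=
    (card_filter_mem_le hK (σ.injective.comp ha) _).trans
      (Nat.mul_le_mul_left _ (card_closedNbhd_le hK ha hb σ w))
  have hlt : (badEdges π a b σ ∪ (E2 ∪ E3)).card < (Finset.univ : Finset ι).card := by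
    have := Finset.card_union_le (badEdges π a b σ) (E2 ∪ E3)
    have := Finset.card_union_le E2 E3
    rw [Finset.card_univ]
    omega
  obtain ⟨s, -, hs⟩ := Finset.exists_mem_notMem_of_card_lt_card hlt
  simp only [Finset.mem_union, not_or, E2, E3, closedNbhd, Finset.mem_filter, Finset.mem_univ,
    true_and, not_exists] at hs
  obtain ⟨hs1, ⟨hs2, hs3⟩, hs4, hs5⟩ := hs
  exact ⟨s, badEdges_swap_ssubset hab ht hs1 hs2 hs3 hs4 hs5⟩

variable [Fintype α] [DecidableEq β]

open Classical in
/-- The pairings with at most `k` bad edges. -/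
noncomputable def fewBad (π : β → V) (a b : ι → α) (k : ℕ) : Finset (α ≃ β) :=
  {σ | (badEdges π a b σ).card ≤ k}

theorem card_fewBad_succ_le {π : β → V} {K : ℕ}
    (hK : ∀ v, (Finset.univ.filter (π · = v)).card ≤ K) {a b : ι → α}
    (hab : Function.Injective (Sum.elim a b)) {k : ℕ}
    (hm : k + 1 + 2 * (K * (1 + 2 * K)) < Fintype.card ι) :
    (fewBad π a b (k + 1)).card ≤ Fintype.card ι ^ 2 * (fewBad π a b k).card := by
  classical
  have hne : Nonempty ι := Fintype.card_pos_iff.1 (by omega)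
  have hsub : fewBad π a b (k + 1) ⊆ (Finset.univ : Finset (ι × ι)).biUnion fun p =>
      (fewBad π a b k).image fun σ => (Equiv.swap (b p.1) (b p.2)).trans σ := by
    intro σ hσ
    have key : ∃ s t, (Equiv.swap (b t) (b s)).trans σ ∈ fewBad π a b k := by
      simp only [fewBad, Finset.mem_filter, Finset.mem_univ, true_and] at hσ ⊢
      by_cases h0 : (badEdges π a b σ).card ≤ k
      · exact ⟨hne.some, hne.some, by simpa using h0⟩
      · obtain ⟨t, ht⟩ : (badEdges π a b σ).Nonempty := Finset.card_pos.1 (by omega)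
        obtain ⟨s, hs⟩ := exists_swap_badEdges_ssubset hK hab ht (by omega)
        exact ⟨s, t, by have := Finset.card_lt_card hs; omega⟩
    obtain ⟨s, t, hst⟩ := key
    simp only [Finset.mem_biUnion, Finset.mem_univ, true_and, Finset.mem_image]
    refine ⟨(t, s), _, hst, ?_⟩
    ext x
    simp
  refine (Finset.card_le_card hsub).trans (Finset.card_biUnion_le.trans ?_)
  refine (Finset.sum_le_sum fun p _ => Finset.card_image_le).trans ?_
  simp [sq]

theorem card_fewBad_le {π : β → V} {K : ℕ}
    (hK : ∀ v, (Finset.univ.filter (π · = v)).card ≤ K) {a b : ι → α}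
    (hab : Function.Injective (Sum.elim a b)) (k : ℕ)
    (hm : k + 2 * (K * (1 + 2 * K)) < Fintype.card ι) :
    (fewBad π a b k).card ≤ (Fintype.card ι ^ 2) ^ k * (fewBad π a b 0).card := by
  induction k with
  | zero => simp
  | succ k ih =>
    refine (card_fewBad_succ_le hK hab hm).trans ?_
    rw [pow_succ' (Fintype.card ι ^ 2), mul_assoc]
    exact Nat.mul_le_mul_left _ (ih (by omega))

end Switching

/-! ### The expected number of bad edges -/

section FirstMoment

theorem card_equiv_filter_eq_le {κ α β : Type*} [Fintype κ] [Fintype α] [Fintype β]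
    [DecidableEq α] [DecidableEq β]
    {f : κ → α} (hf : Function.Injective f) (g : κ → β) :
    (Finset.univ.filter fun σ : α ≃ β => ∀ k, σ (f k) = g k).card ≤
      (Fintype.card α - Fintype.card κ).factorial := by
  classical
  rcases (Finset.univ.filter fun σ : α ≃ β => ∀ k, σ (f k) = g k).eq_empty_or_nonempty with h | h
  · simp [h]
  obtain ⟨σ₀, hσ₀⟩ := h
  simp only [Finset.mem_filter, Finset.mem_univ, true_and] at hσ₀
  have hcard : Fintype.card {x // x ∉ Set.range f} = Fintype.card α - Fintype.card κ := by
    rw [Fintype.card_subtype_compl]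
    congr 1
    exact Set.card_range_of_injective hf
  rw [← hcard, ← Fintype.card_perm,
    Fintype.card_congr (Equiv.Perm.subtypeEquivSubtypePerm (fun x => x ∉ Set.range f)),
    Fintype.card_subtype]
  -- compared with `σ₀`, such a bijection is a permutation that fixes the range of `f`
  refine Finset.card_le_card_of_injOn (fun σ => σ.trans σ₀.symm) (fun σ hσ => ?_)
    fun σ _ τ _ h => ?_
  · simp only [Finset.coe_filter, Finset.mem_univ, true_and, Set.mem_ofPred_eq] at hσ ⊢
    intro x hx
    obtain ⟨k, rfl⟩ := not_not.1 hx
    simp [hσ k, ← hσ₀ k]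
  · ext x
    have := congrArg (fun e => σ₀ (e x)) h
    simpa using this

/-- A uniformly random bijection takes given values at `k` given points with probability at most
`1 / (N (N - 1) ⋯ (N - k + 1))`. -/
theorem card_equiv_filter_mem_le {κ α β : Type*} [Fintype κ] [Fintype α] [Fintype β]
    [DecidableEq α] [DecidableEq β] [DecidableEq κ]
    {f : κ → α} (hf : Function.Injective f) (S : Finset (κ → β)) :
    (Finset.univ.filter fun σ : α ≃ β => (fun k => σ (f k)) ∈ S).card ≤
      S.card * (Fintype.card α - Fintype.card κ).factorial := by
  rw [mul_comm]
  refine Finset.card_le_mul_card_image_of_maps_to (f := fun (σ : α ≃ β) k => σ (f k))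
    (fun σ hσ => by simpa using hσ) _ fun g _ => ?_
  refine le_trans (Finset.card_le_card fun σ hσ => ?_) (card_equiv_filter_eq_le hf g)
  simp only [Finset.mem_filter, Finset.mem_univ, true_and] at hσ ⊢
  exact fun k => congrFun hσ.2 k

variable {ι α β V : Type*} [Fintype α] [Fintype β] [DecidableEq α] [DecidableEq β]
  [DecidableEq V]

theorem card_loop_le {π : β → V} {K : ℕ} (hK : ∀ v, (Finset.univ.filter (π · = v)).card ≤ K)
    {a b : ι → α} (hab : Function.Injective (Sum.elim a b)) (t : ι) :
    (Finset.univ.filter fun σ : α ≃ β => (pairEdge π a b σ t).IsDiag).card ≤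
      Fintype.card β * K * (Fintype.card α - 2).factorial := by
  have hinj : Function.Injective (![a t, b t] : Fin 2 → α) := by
    have : (![a t, b t] : Fin 2 → α) = Sum.elim a b ∘ ![Sum.inl t, Sum.inr t] := by
      ext i; fin_cases i <;> rfl
    rw [this]
    refine hab.comp fun i j => ?_
    fin_cases i <;> fin_cases j <;> simp
  have h := card_equiv_filter_mem_le (β := β) hinj
    (Finset.univ.filter fun g : Fin 2 → β => π (g 0) = π (g 1))
  have hS : (Finset.univ.filter fun g : Fin 2 → β => π (g 0) = π (g 1)).card ≤
      Fintype.card β * K := by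
    rw [mul_comm, ← Finset.card_univ (α := β)]
    refine Finset.card_le_mul_card_image_of_maps_to (f := fun g => g 0) (fun _ _ => by simp) K
      fun p _ => le_trans (Finset.card_le_card_of_injOn (fun g => g 1) (fun g hg => ?_)
        fun g hg g' hg' hh => ?_) (hK (π p))
    · simp at hg ⊢
      rw [← hg.1, hg.2]
    · simp at hg hg' hh
      ext i
      fin_cases i
      · simp [hg.2, hg'.2]
      · simpa using hh
  refine le_trans (le_of_eq ?_) (h.trans (Nat.mul_le_mul_right _ hS))
  congr 1
  ext σ
  simp [pairEdge]

theorem card_parallel_le {π : β → V} {K : ℕ} (hK : ∀ v, (Finset.univ.filter (π · = v)).card ≤ K)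
    {a b : ι → α} (hab : Function.Injective (Sum.elim a b)) {s t : ι} (hst : s ≠ t) :
    (Finset.univ.filter fun σ : α ≃ β => pairEdge π a b σ s = pairEdge π a b σ t).card ≤
      Fintype.card β ^ 2 * (2 * K ^ 2) * (Fintype.card α - 4).factorial := by
  have hinj : Function.Injective (![a s, b s, a t, b t] : Fin 4 → α) := by
    have : (![a s, b s, a t, b t] : Fin 4 → α) =
        Sum.elim a b ∘ ![Sum.inl s, Sum.inr s, Sum.inl t, Sum.inr t] := by
      ext i; fin_cases i <;> rfl
    rw [this]
    refine hab.comp fun i j => ?_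
    fin_cases i <;> fin_cases j <;> simp [hst, hst.symm]
  set S : Finset (Fin 4 → β) :=
    Finset.univ.filter fun g => s(π (g 0), π (g 1)) = s(π (g 2), π (g 3))
  have h := card_equiv_filter_mem_le (β := β) hinj S
  have hS : S.card ≤ Fintype.card β ^ 2 * (2 * K ^ 2) := by
    rw [mul_comm, sq (Fintype.card β), ← Fintype.card_prod, ← Finset.card_univ (α := β × β)]
    refine Finset.card_le_mul_card_image_of_maps_to (f := fun g => (g 0, g 1)) (fun _ _ => by simp)
      _ fun p _ => ?_
    have hle : (Finset.univ.filter fun q : β × β => s(π p.1, π p.2) = s(π q.1, π q.2)).card ≤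
        2 * K ^ 2 := by
      have hsub : (Finset.univ.filter fun q : β × β => s(π p.1, π p.2) = s(π q.1, π q.2)) ⊆
          (Finset.univ.filter (π · = π p.1)) ×ˢ (Finset.univ.filter (π · = π p.2)) ∪
          (Finset.univ.filter (π · = π p.2)) ×ˢ (Finset.univ.filter (π · = π p.1)) := by
        intro q hq
        simp only [Finset.mem_filter, Finset.mem_univ, true_and, Sym2.eq_iff] at hq
        simp only [Finset.mem_union, Finset.mem_product, Finset.mem_filter, Finset.mem_univ,
          true_and]
        rcases hq with ⟨h1, h2⟩ | ⟨h1, h2⟩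
        · exact Or.inl ⟨h1.symm, h2.symm⟩
        · exact Or.inr ⟨h2.symm, h1.symm⟩
      refine (Finset.card_le_card hsub).trans ((Finset.card_union_le _ _).trans ?_)
      rw [Finset.card_product, Finset.card_product]
      have := Nat.mul_le_mul (hK (π p.1)) (hK (π p.2))
      have := Nat.mul_le_mul (hK (π p.2)) (hK (π p.1))
      nlinarith
    refine le_trans (Finset.card_le_card_of_injOn (fun g => (g 2, g 3)) (fun g hg => ?_)
        fun g hg g' hg' hh => ?_) hle
    · simp [S] at hg ⊢
      obtain ⟨hg1, rfl⟩ := hg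
      simpa using hg1
    · simp [S] at hg hg' hh
      have h0 := congrArg Prod.fst (hg.2.trans hg'.2.symm)
      have h1 := congrArg Prod.snd (hg.2.trans hg'.2.symm)
      ext i
      fin_cases i
      · simpa using h0
      · simpa using h1
      · simpa using hh.1
      · simpa using hh.2
  refine le_trans (le_of_eq ?_) (h.trans (Nat.mul_le_mul_right _ hS))
  congr 1
  ext σ
  simp [pairEdge, S]

variable [Fintype ι]

theorem sum_card_badEdges_le {π : β → V} {K : ℕ}
    (hK : ∀ v, (Finset.univ.filter (π · = v)).card ≤ K)
    {a b : ι → α} (hab : Function.Injective (Sum.elim a b)) :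
    ∑ σ : α ≃ β, (badEdges π a b σ).card ≤
      Fintype.card ι * (Fintype.card β * K * (Fintype.card α - 2).factorial) +
      Fintype.card ι ^ 2 *
        (Fintype.card β ^ 2 * (2 * K ^ 2) * (Fintype.card α - 4).factorial) := by
  classical
  have h1 : ∀ σ : α ≃ β, (badEdges π a b σ).card ≤
      ∑ t, ((if (pairEdge π a b σ t).IsDiag then 1 else 0) +
        ∑ s ∈ Finset.univ.erase t, if pairEdge π a b σ s = pairEdge π a b σ t then 1 else 0) := by
    intro σ
    rw [badEdges, Finset.card_filter]
    refine Finset.sum_le_sum fun t _ => ?_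
    split_ifs with h1 h2
    · omega
    · obtain ⟨s, hst, hs⟩ := h1.resolve_left h2
      refine le_add_left (le_trans (by simp [hs]) (Finset.single_le_sum
        (f := fun s => if pairEdge π a b σ s = pairEdge π a b σ t then 1 else 0)
        (fun _ _ => Nat.zero_le _)
        (Finset.mem_erase.2 ⟨hst, Finset.mem_univ s⟩)))
    · omega
    · omega
  refine (Finset.sum_le_sum fun σ _ => h1 σ).trans ?_
  rw [Finset.sum_comm]
  simp only [Finset.sum_add_distrib]
  refine add_le_add ?_ ?_
  · rw [← smul_eq_mul, ← Finset.card_univ]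
    refine Finset.sum_le_card_nsmul _ _ _ fun t _ => ?_
    rw [← Finset.card_filter]
    exact card_loop_le hK hab t
  · rw [sq, mul_assoc, ← smul_eq_mul (Fintype.card ι), ← Finset.card_univ (α := ι)]
    refine Finset.sum_le_card_nsmul _ _ _ fun t _ => ?_
    rw [Finset.sum_comm]
    refine le_trans (Finset.sum_le_card_nsmul _ _ _ fun s hs => ?_)
      (Nat.mul_le_mul_right _ (Finset.card_le_univ (Finset.univ.erase t)))
    rw [← Finset.card_filter]
    exact card_parallel_le hK hab (Finset.mem_erase.1 hs).1

/-- The expected number of bad edges of a uniformly random pairing is bounded. -/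
theorem sum_card_badEdges_le_mul_factorial {π : β → V} {K : ℕ}
    (hK : ∀ v, (Finset.univ.filter (π · = v)).card ≤ K)
    {a b : ι → α} (hab : Function.Injective (Sum.elim a b))
    (hαβ : Fintype.card α = Fintype.card β) (hα : 8 ≤ Fintype.card α) :
    ∑ σ : α ≃ β, (badEdges π a b σ).card ≤ (K + 4 * K ^ 2) * (Fintype.card α).factorial := by
  have hι : 2 * Fintype.card ι ≤ Fintype.card α := by
    have := Fintype.card_le_of_injective _ hab
    rw [Fintype.card_sum] at this
    omega
  refine (sum_card_badEdges_le hK hab).trans ?_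
  rw [← hαβ, add_mul]
  obtain ⟨N, hN⟩ := Nat.exists_eq_add_of_le hα
  rw [hN] at hι ⊢
  generalize Fintype.card ι = m at hι ⊢
  refine add_le_add ?_ ?_
  · have e : (8 + N).factorial = (8 + N) * ((7 + N) * (8 + N - 2).factorial) := by
      rw [show 8 + N - 2 = 6 + N by omega, show 8 + N = (6 + N) + 1 + 1 by omega,
        Nat.factorial_succ, Nat.factorial_succ]
      ring
    rw [e]
    have : m ≤ 7 + N := by omega
    calc m * ((8 + N) * K * (8 + N - 2).factorial)
        = K * ((8 + N) * (m * (8 + N - 2).factorial)) := by ring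
      _ ≤ _ := by gcongr
  · have e : (8 + N).factorial =
        (8 + N) * ((7 + N) * ((6 + N) * ((5 + N) * (8 + N - 4).factorial))) := by
      rw [show 8 + N - 4 = 4 + N by omega, show 8 + N = (4 + N) + 1 + 1 + 1 + 1 by omega,
        Nat.factorial_succ, Nat.factorial_succ, Nat.factorial_succ, Nat.factorial_succ]
      ring
    rw [e]
    -- with `M = 8 + N`, both `2 m ≤ M` and `M ≤ 2 (M - 3)`
    have h2 : m * (8 + N) ≤ 2 * ((6 + N) * (5 + N)) := by nlinarith
    have h3 : m ≤ 7 + N := by omega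
    calc m ^ 2 * ((8 + N) ^ 2 * (2 * K ^ 2) * (8 + N - 4).factorial)
        = 2 * K ^ 2 * ((8 + N) * (m * ((m * (8 + N)) * (8 + N - 4).factorial))) := by ring
      _ ≤ 2 * K ^ 2 * ((8 + N) * ((7 + N) * ((2 * ((6 + N) * (5 + N))) *
          (8 + N - 4).factorial))) := by gcongr
      _ = _ := by ring

/-- The proportion of pairings without bad edges decays at most polynomially in the number of
edges. -/
theorem factorial_le_card_fewBad_zero [Fintype V] {π : β → V} {K : ℕ}
    (hK : ∀ v, (Finset.univ.filter (π · = v)).card ≤ K)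
    {a b : ι → α} (hab : Function.Injective (Sum.elim a b))
    (hαβ : Fintype.card α = Fintype.card β) (hα : 8 ≤ Fintype.card α)
    (hι : 2 * (K + 4 * K ^ 2) + 2 * (K * (1 + 2 * K)) < Fintype.card ι) :
    (Fintype.card α).factorial ≤
      2 * (Fintype.card ι ^ 2) ^ (2 * (K + 4 * K ^ 2)) * (fewBad π a b 0).card := by
  classical
  set B := 2 * (K + 4 * K ^ 2)
  have h1 := sum_card_badEdges_le_mul_factorial hK hab hαβ hα
  have h2 := card_fewBad_le hK hab B hι
  have htot : Fintype.card (α ≃ β) = (Fintype.card α).factorial :=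
    Fintype.card_equiv (Fintype.equivOfCardEq hαβ)
  -- Markov's inequality
  have h3 : (B + 1) * (Finset.univ \ fewBad π a b B).card ≤
      ∑ σ : α ≃ β, (badEdges π a b σ).card := by
    rw [mul_comm, ← smul_eq_mul]
    refine (Finset.card_nsmul_le_sum _ (fun σ => (badEdges π a b σ).card) _ fun σ hσ => ?_).trans
      (Finset.sum_le_sum_of_subset (Finset.subset_univ _))
    simp [fewBad] at hσ
    omega
  have h4 : (Finset.univ \ fewBad π a b B).card + (fewBad π a b B).card =
      (Fintype.card α).factorial := by
    rw [← htot, ← Finset.card_univ]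
    exact Finset.card_sdiff_add_card_eq_card (Finset.subset_univ _)
  have h5 : 2 * (Finset.univ \ fewBad π a b B).card ≤ (Fintype.card α).factorial := by
    have h6 : (B + 1) * (2 * (Finset.univ \ fewBad π a b B).card) ≤
        (B + 1) * (Fintype.card α).factorial := by
      have : 2 * ((K + 4 * K ^ 2) * (Fintype.card α).factorial) =
        B * (Fintype.card α).factorial := by simp only [B]; ring
      nlinarith
    exact Nat.le_of_mul_le_mul_left h6 (Nat.succ_pos B)
  have : (Fintype.card α).factorial ≤ 2 * (fewBad π a b B).card := by omega
  refine this.trans ?_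
  rw [mul_assoc]
  exact Nat.mul_le_mul_left _ h2

end FirstMoment

/-! ### Simplicity of a run with given numbers of stubs -/

section RunLaw

/-- The position of the first stub of the `t`-th edge. -/
def firstEnd (M : ℕ) (t : Fin (M / 2)) : Fin M := ⟨2 * t, by omega⟩

/-- The position of the second stub of the `t`-th edge. -/
def secondEnd (M : ℕ) (t : Fin (M / 2)) : Fin M := ⟨2 * t + 1, by omega⟩

theorem injective_ends (M : ℕ) : Function.Injective (Sum.elim (firstEnd M) (secondEnd M)) := by
  rintro (s | s) (t | t) h <;>
    simp only [Sum.elim_inl, Sum.elim_inr, firstEnd, secondEnd, Fin.mk.injEq] at h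
  · congr 1; ext; omega
  · omega
  · omega
  · congr 1; ext; omega

theorem isSimple_iff {n : ℕ} (d : Fin n → ℕ) (σ : PickOrder d) :
    (Run.mk d σ).IsSimple ↔ badEdges Sigma.fst (firstEnd _) (secondEnd _) σ = ∅ := by
  have he : ∀ t, (Run.mk d σ).edge t = pairEdge Sigma.fst (firstEnd _) (secondEnd _) σ t :=
    fun t => rfl
  rw [Finset.eq_empty_iff_forall_notMem]
  constructor
  · rintro ⟨h1, h2⟩ t ht
    rcases mem_badEdges.1 ht with h | ⟨s, hst, h⟩
    · exact h1 t h
    · exact hst (h2 h)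
  · intro h
    refine ⟨fun t ht => h t (mem_badEdges.2 (Or.inl ht)), fun s t hst => ?_⟩
    by_contra hne
    exact h t (mem_badEdges.2 (Or.inr ⟨s, hne, hst⟩))

theorem card_stub_filter_eq {n : ℕ} (d : Fin n → ℕ) (v : Fin n) :
    (Finset.univ.filter fun p : Stub d => p.1 = v).card = d v := by
  classical
  have : (Finset.univ.filter fun p : Stub d => p.1 = v) =
      Finset.univ.map ⟨fun k : Fin (d v) => (⟨v, k⟩ : Stub d), fun k l h => by simpa using h⟩ := by
    ext ⟨i, k⟩
    simp only [Finset.mem_filter, Finset.mem_univ, true_and, Finset.mem_map]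
    constructor
    · rintro rfl
      exact ⟨k, rfl⟩
    · rintro ⟨l, hl⟩
      exact (congrArg Sigma.fst hl).symm
  rw [this, Finset.card_map, Finset.card_univ, Fintype.card_fin]

/-- A number of edges from which on, for at most `K` stubs per vertex, the first moment bound and
the switching apply. It exceeds the number `2 (K + 4 K ^ 2)` of bad edges to be switched away, and
so also serves as an exponent in `inv_pow_le_toMeasure_isSimple`. -/
def edgeThreshold (K : ℕ) : ℕ := 2 * (K + 4 * K ^ 2) + 2 * (K * (1 + 2 * K)) + 4

/-- Given the numbers of stubs, if they are bounded and there are enough stubs, a run is simple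
with at least polynomially small probability. -/
theorem inv_pow_le_toMeasure_isSimple {n K : ℕ} (d : Fin n → ℕ) (hK : ∀ i, d i ≤ K)
    (hM : 2 * edgeThreshold K ≤ ∑ i, d i) :
    ((2 * ((n * K) ^ 2) ^ edgeThreshold K : ℕ) : ENNReal)⁻¹ ≤
      ((PMF.uniformOfFintype (PickOrder d)).map fun σ => Run.mk d σ).toMeasure
        {r | r.IsSimple} := by
  classical
  have hle : ∑ i, d i ≤ n * K := by
    simpa using Finset.sum_le_card_nsmul Finset.univ d K fun i _ => hK i
  have h := factorial_le_card_fewBad_zero (π := (Sigma.fst : Stub d → Fin n))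
    (a := firstEnd (∑ i, d i)) (b := secondEnd (∑ i, d i)) (K := K)
    (fun v => (card_stub_filter_eq d v).trans_le (hK v)) (injective_ends _) (by simp)
    (by simp [edgeThreshold] at hM ⊢; omega) (by simp [edgeThreshold] at hM ⊢; omega)
  rw [Fintype.card_fin, Fintype.card_fin] at h
  have hpos : 1 ≤ n * K := by simp [edgeThreshold] at hM; omega
  have h' : (∑ i, d i).factorial ≤ 2 * ((n * K) ^ 2) ^ edgeThreshold K *
      (fewBad (Sigma.fst : Stub d → Fin n) (firstEnd (∑ i, d i)) (secondEnd (∑ i, d i)) 0).card := by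
    refine h.trans (Nat.mul_le_mul_right _ (Nat.mul_le_mul_left _ ?_))
    calc (((∑ i, d i) / 2) ^ 2) ^ (2 * (K + 4 * K ^ 2))
        ≤ ((n * K) ^ 2) ^ (2 * (K + 4 * K ^ 2)) := by
          gcongr; omega
      _ ≤ ((n * K) ^ 2) ^ edgeThreshold K := by
          apply Nat.pow_le_pow_right
          · positivity
          · simp only [edgeThreshold]; omega
  let _ : MeasurableSpace (PickOrder d) := ⊤
  rw [PMF.toMeasure_map_apply _ _ {r : Run n | r.IsSimple} measurable_from_top
      MeasurableSpace.measurableSet_top,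
    PMF.toMeasure_uniformOfFintype_apply _ MeasurableSpace.measurableSet_top]
  have hcard : Fintype.card (PickOrder d) = (∑ i, d i).factorial := by
    rw [Fintype.card_equiv finSigmaFinEquiv.symm, Fintype.card_fin]
  have hset : Fintype.card ((fun σ => Run.mk d σ) ⁻¹' {r | r.IsSimple}) =
      (fewBad (Sigma.fst : Stub d → Fin n) (firstEnd (∑ i, d i)) (secondEnd (∑ i, d i)) 0).card := by
    rw [← Set.toFinset_card]
    congr 1
    ext σ
    simp [fewBad, isSimple_iff]
  rw [hcard, hset]
  rw [ENNReal.le_div_iff_mul_le (Or.inl (by simp [Nat.factorial_ne_zero])) (Or.inl (by simp)),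
    ENNReal.inv_mul_le_iff (Nat.cast_ne_zero.2 (by positivity)) (ENNReal.natCast_ne_top _)]
  exact_mod_cast h'

theorem stubLaw_apply (F : PMF ℕ) (n : ℕ) (d : Fin n → ℕ) : stubLaw F n d = ∏ i, F (d i) := by
  rw [stubLaw, Measure.toPMF_apply, Measure.pi_singleton]
  simp [PMF.toMeasure_apply_singleton]

theorem sum_stubLaw_mul_le {F : PMF ℕ} {n : ℕ} {A : Set (Run n)} {T : Finset (Fin n → ℕ)}
    {c : ENNReal} (hc : ∀ d ∈ T, c ≤
      ((PMF.uniformOfFintype (PickOrder d)).map fun σ => Run.mk d σ).toMeasure A) :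
    (∑ d ∈ T, stubLaw F n d) * c ≤ (runLaw F n).toMeasure A := by
  rw [runLaw, PMF.toMeasure_bind_apply _ _ A (MeasurableSpace.measurableSet_top), Finset.sum_mul]
  exact (Finset.sum_le_sum fun d hd => by gcongr; exact hc d hd).trans (ENNReal.sum_le_tsum T)

end RunLaw

/-! ### A lower bound for the probability of acceptance -/

section Acceptance

/-- The parity of the total number of stubs can be corrected by the number of stubs of a single
vertex, and finitely many numbers from the support of `F` suffice for this. -/
theorem exists_parity_correction {F : PMF ℕ} (rule : ParityRule) {a : ℕ} (ha : a ∈ F.support) :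
    ∃ X : Finset ℕ, X.Nonempty ∧ (∀ x ∈ X, x ∈ F.support) ∧
      ∀ n, n + 1 ∈ admissible F rule → ∀ d : Fin n → ℕ, (∀ i, d i ∈ F.support) →
        ∃ x ∈ X, rule = .regenerate → Even (x + ∑ i, d i) := by
  cases rule with
  | removeStub =>
    exact ⟨{a}, by simp, by simpa using ha, fun n _ d _ => ⟨a, by simp⟩⟩
  | regenerate =>
    by_cases hodd : ∃ o ∈ F.support, Odd o
    · obtain ⟨o, ho, ho'⟩ := hodd
      by_cases heven : ∃ e ∈ F.support, Even e
      · obtain ⟨e, he, he'⟩ := heven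
        refine ⟨{e, o}, by simp, ?_, fun n _ d _ => ?_⟩
        · simp only [Finset.mem_insert, Finset.mem_singleton]
          rintro x (rfl | rfl) <;> assumption
        · rcases Nat.even_or_odd (∑ i, d i) with h | h
          · exact ⟨e, by simp, fun _ => he'.add h⟩
          · exact ⟨o, by simp, fun _ => ho'.add_odd h⟩
      · refine ⟨{o}, by simp, by simpa using ho, fun n hn d hd => ⟨o, by simp, fun _ => ?_⟩⟩
        have hall : ∀ k ∈ F.support, Odd k := fun k hk =>
          Nat.not_even_iff_odd.1 fun h => heven ⟨k, hk, h⟩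
        have hn' : Odd n := by
          have : ¬ Odd (n + 1) := fun h => hn ⟨h, hall⟩
          rw [Nat.not_odd_iff_even, Nat.even_add_one, Nat.not_even_iff_odd] at this
          exact this
        refine ho'.add_odd ?_
        rw [Finset.odd_sum_iff_odd_card_odd, Finset.filter_true_of_mem fun i _ => hall _ (hd i)]
        simpa using hn'
    · have hall : ∀ k ∈ F.support, Even k := fun k hk =>
        Nat.not_odd_iff_even.1 fun h => hodd ⟨k, hk, h⟩
      exact ⟨{a}, by simp, by simpa using ha, fun n _ d hd => ⟨a, by simp, fun _ =>
        (hall a ha).add (Finset.even_sum _ fun i _ => hall _ (hd i))⟩⟩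

theorem exists_finset_lt_sum (F : PMF ℕ) {q : ENNReal} (hq : q < 1) :
    ∃ S : Finset ℕ, (∀ k ∈ S, k ∈ F.support) ∧ q < ∑ k ∈ S, F k := by
  classical
  have h : Tendsto (fun s : Finset ℕ => ∑ k ∈ s, F k) atTop (𝓝 1) := by
    have := ENNReal.summable.hasSum (f := fun k => F k)
    rwa [F.tsum_coe] at this
  obtain ⟨S, hS⟩ := (h.eventually (lt_mem_nhds hq)).exists
  refine ⟨S.filter fun k => F k ≠ 0, fun k hk => ?_, ?_⟩
  · simpa using (Finset.mem_filter.1 hk).2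
  · rwa [Finset.sum_filter_ne_zero]

theorem le_toMeasure_accepted {n K : ℕ} {rule : ParityRule} (d : Fin n → ℕ) (hK : ∀ i, d i ≤ K)
    (hM : 2 * edgeThreshold K ≤ ∑ i, d i) (hd : rule = .regenerate → Even (∑ i, d i)) :
    ((2 * ((n * K) ^ 2) ^ edgeThreshold K : ℕ) : ENNReal)⁻¹ ≤
      ((PMF.uniformOfFintype (PickOrder d)).map fun σ => Run.mk d σ).toMeasure
        {r | Accepted rule r} := by
  refine (inv_pow_le_toMeasure_isSimple d hK hM).trans (le_of_eq ?_)
  let _ : MeasurableSpace (PickOrder d) := ⊤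
  rw [PMF.toMeasure_map_apply _ _ {r : Run n | r.IsSimple} measurable_from_top
      MeasurableSpace.measurableSet_top,
    PMF.toMeasure_map_apply _ _ {r : Run n | Accepted rule r} measurable_from_top
      MeasurableSpace.measurableSet_top]
  congr 1
  ext σ
  cases rule with
  | removeStub => rfl
  | regenerate =>
    exact ⟨fun h => ⟨hd rfl, h⟩, fun h => h.2⟩

/-- The probability of acceptance is at least of the order `q ^ n / n ^ c` for each `q < 1`: let
boundedly many vertices have `a` stubs, let one vertex correct the parity, and let the numbers of
stubs of the other vertices be bounded. -/
theorem le_runLaw_accepted (F : PMF ℕ) (rule : ParityRule) {a : ℕ} (ha : a ∈ F.support)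
    (ha0 : a ≠ 0) {q : ENNReal} (hq : q < 1) :
    ∃ (δ : ENNReal) (K c m : ℕ), δ ≠ 0 ∧ 0 < K ∧ ∀ n, m ≤ n → n + 1 ∈ admissible F rule →
      δ * q ^ n * ((2 * (((n + 1) * K) ^ 2) ^ c : ℕ) : ENNReal)⁻¹ ≤
        (runLaw F (n + 1)).toMeasure {r | Accepted rule r} := by
  classical
  obtain ⟨X, hXne, hX, hpar⟩ := exists_parity_correction rule ha
  obtain ⟨S, hS, hqS⟩ := exists_finset_lt_sum F hq
  obtain ⟨x₀, hx₀, hmin⟩ := Finset.exists_min_image X (fun x => F x) hXne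
  set K := (insert a (X ∪ S)).sup id
  have hKle : ∀ k ∈ insert a (X ∪ S), k ≤ K := fun k hk => Finset.le_sup (f := id) hk
  have haK : a ≤ K := hKle a (by simp)
  refine ⟨F x₀ * F a ^ (2 * edgeThreshold K), K, edgeThreshold K, 2 * edgeThreshold K, ?_, by omega,
    fun n hn hadm => ?_⟩
  · exact mul_ne_zero ((F.mem_support_iff _).1 (hX _ hx₀))
      (pow_ne_zero _ ((F.mem_support_iff _).1 ha))
  set r := 2 * edgeThreshold K
  set τ : Fin n → Finset ℕ := fun i => if (i : ℕ) < r then {a} else S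
  have hτ : ∀ i, ∀ k ∈ τ i, k ∈ F.support ∧ k ≤ K := by
    intro i k hk
    simp only [τ] at hk
    split_ifs at hk
    · rw [Finset.mem_singleton] at hk
      exact hk ▸ ⟨ha, haK⟩
    · exact ⟨hS k hk, hKle k (by simp [hk])⟩
  have hcorr : ∀ d : Fin n → ℕ, ∃ x ∈ X, d ∈ Fintype.piFinset τ →
      rule = .regenerate → Even (x + ∑ i, d i) := by
    intro d
    by_cases hd : d ∈ Fintype.piFinset τ
    · obtain ⟨x, hx, hx'⟩ := hpar n hadm d fun i => (hτ i _ (Fintype.mem_piFinset.1 hd i)).1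
      exact ⟨x, hx, fun _ => hx'⟩
    · exact ⟨x₀, hx₀, fun h => (hd h).elim⟩
  choose x hxX hxeven using hcorr
  have hinj : Function.Injective fun d : Fin n → ℕ => (Fin.cons (x d) d : Fin (n + 1) → ℕ) := by
    intro d d' h
    exact (Fin.cons_injective2 h).2
  refine le_trans ?_ (sum_stubLaw_mul_le (T := (Fintype.piFinset τ).map ⟨_, hinj⟩)
    (c := ((2 * (((n + 1) * K) ^ 2) ^ edgeThreshold K : ℕ) : ENNReal)⁻¹) ?_)
  · rw [Finset.sum_map]
    refine mul_le_mul' ?_ le_rfl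
    calc F x₀ * F a ^ r * q ^ n
        = F x₀ * (F a ^ r * q ^ n) := mul_assoc _ _ _
      _ ≤ F x₀ * ∏ i, ∑ k ∈ τ i, F k := by
          gcongr
          have h1 : F a ^ r * q ^ n = ∏ i : Fin n, (if (i : ℕ) < r then F a else 1) * q := by
            rw [Finset.prod_mul_distrib, Finset.prod_const, Finset.card_univ, Fintype.card_fin,
              Finset.prod_ite, Finset.prod_const, Finset.prod_const_one, mul_one]
            congr 2
            rw [Fin.card_filter_val_lt, min_eq_right hn]
          rw [h1]
          refine Finset.prod_le_prod' fun i _ => ?_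
          simp only [τ]
          split_ifs
          · rw [Finset.sum_singleton]
            exact mul_le_of_le_one_right' hq.le
          · rw [one_mul]
            exact hqS.le
      _ = ∑ d ∈ Fintype.piFinset τ, F x₀ * ∏ i, F (d i) := by
          rw [Finset.prod_univ_sum, Finset.mul_sum]
      _ ≤ _ := by
          refine Finset.sum_le_sum fun d _ => ?_
          rw [Function.Embedding.coeFn_mk, stubLaw_apply, Fin.prod_univ_succ]
          simp only [Fin.cons_zero, Fin.cons_succ]
          gcongr
          exact hmin _ (hxX d)
  · intro d' hd'
    obtain ⟨d, hd, rfl⟩ := Finset.mem_map.1 hd'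
    simp only [Function.Embedding.coeFn_mk]
    have hd1 := Fintype.mem_piFinset.1 hd
    refine le_toMeasure_accepted _ ?_ ?_ ?_
    · intro i
      refine Fin.cases ?_ (fun i => ?_) i
      · simpa using hKle _ (by simp [hxX d])
      · simpa using (hτ i _ (hd1 i)).2
    · rw [Fin.sum_univ_succ]
      simp only [Fin.cons_zero, Fin.cons_succ]
      refine le_add_left ?_
      calc r = ∑ i : Fin n, if (i : ℕ) < r then 1 else 0 := by
            rw [← Finset.card_filter, Fin.card_filter_val_lt, min_eq_right hn]
        _ ≤ ∑ i, d i := by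
            refine Finset.sum_le_sum fun i _ => ?_
            split_ifs with h
            · have := hd1 i
              simp only [τ, h, if_true, Finset.mem_singleton] at this
              omega
            · exact Nat.zero_le _
    · rw [Fin.sum_univ_succ]
      simp only [Fin.cons_zero, Fin.cons_succ]
      exact hxeven d hd

end Acceptance

/-! ### Subexponential decay of the probability of acceptance -/

section AcceptanceAsymptotics

theorem eventually_of_eventually_succ {s : Set ℕ} {p : ℕ → Prop}
    (h : ∀ᶠ n : ℕ in atTop, n + 1 ∈ s → p (n + 1)) : ∀ᶠ n in atTop ⊓ 𝓟 s, p n := by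
  rw [eventually_inf_principal]
  exact (eventually_map (m := fun n => n + 1) (P := fun n => n ∈ s → p n)).2 h |>.filter_mono
    (map_add_atTop_eq_nat 1).ge

/-- The case that `F` is concentrated at `0`, in which all runs have no edges. -/
theorem one_le_runLaw_accepted {F : PMF ℕ} (h0 : ∀ k ∈ F.support, k = 0) (rule : ParityRule)
    (n : ℕ) : 1 ≤ (runLaw F n).toMeasure {r | Accepted rule r} := by
  have hF0 : F 0 = 1 := by
    rw [F.apply_eq_one_iff]
    obtain ⟨k, hk⟩ := F.support_nonempty
    ext j
    constructor
    · exact fun hj => h0 j hj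
    · rintro rfl
      exact h0 k hk ▸ hk
  have h := sum_stubLaw_mul_le (F := F) (n := n) (A := {r | Accepted rule r}) (T := {fun _ => 0})
    (c := 1) ?_
  · simpa [stubLaw_apply, hF0] using h
  · intro d hd
    rw [Finset.mem_singleton] at hd
    subst hd
    let _ : MeasurableSpace (PickOrder fun _ : Fin n => 0) := ⊤
    rw [PMF.toMeasure_map_apply _ _ {r : Run n | Accepted rule r} measurable_from_top
      MeasurableSpace.measurableSet_top]
    have huniv : (fun σ => Run.mk (fun _ : Fin n => 0) σ) ⁻¹' {r | Accepted rule r} =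
        Set.univ := by
      refine Set.eq_univ_of_forall fun σ => ?_
      have hs : (Run.mk (fun _ : Fin n => 0) σ).IsSimple := by
        have hno : ∀ t : Fin ((∑ i, (Run.mk (fun _ : Fin n => 0) σ).stubs i) / 2), False := by
          intro t
          have := t.2
          simp at this
        exact ⟨fun t => (hno t).elim, fun t => (hno t).elim⟩
      cases rule with
      | removeStub => exact hs
      | regenerate => exact ⟨by simp, hs⟩
    rw [huniv, measure_univ]

/-- The probability of acceptance decays more slowly than any exponential. -/
theorem eventually_exp_le_runLaw_accepted (F : PMF ℕ) (rule : ParityRule) {c : ℝ} (hc : 0 < c) :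
    ∀ᶠ n : ℕ in atTop ⊓ 𝓟 (admissible F rule),
      Real.exp (-c * n) ≤ (runLaw F n).toMeasure.real {r | Accepted rule r} := by
  by_cases h0 : ∀ k ∈ F.support, k = 0
  · refine Eventually.of_forall fun n => ?_
    have h1 : (1 : ℝ) ≤ (runLaw F n).toMeasure.real {r | Accepted rule r} := by
      have := ENNReal.toReal_mono (measure_ne_top _ _) (one_le_runLaw_accepted h0 rule n)
      rwa [ENNReal.toReal_one] at this
    refine le_trans ?_ h1
    rw [Real.exp_le_one_iff]
    have : 0 ≤ c * n := by positivity
    linarith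
  push Not at h0
  obtain ⟨a, ha, ha0⟩ := h0
  obtain ⟨δ, K, e, m, hδ, hK, hle⟩ := le_runLaw_accepted F rule ha ha0
    (q := ENNReal.ofReal (Real.exp (-(c / 2)))) (by
      rw [ENNReal.ofReal_lt_one, Real.exp_lt_one_iff]; linarith)
  -- the minimum avoids the junk value `0` of `ENNReal.toReal` at `⊤`
  set δ' := (min δ 1).toReal
  have hδ' : 0 < δ' := ENNReal.toReal_pos (by simp [hδ]) (by simp)
  have hlim : Tendsto (fun n : ℕ => 2 * (K : ℝ) ^ (2 * e) * (((n + 1 : ℕ) : ℝ) ^ (2 * e) /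
      Real.exp (c / 2 * ((n + 1 : ℕ) : ℝ)))) atTop (𝓝 (2 * (K : ℝ) ^ (2 * e) * 0)) := by
    have h1 := (isLittleO_pow_exp_pos_mul_atTop (2 * e) (half_pos hc)).tendsto_div_nhds_zero
    exact ((h1.comp (tendsto_natCast_atTop_atTop (R := ℝ))).comp
      (tendsto_add_atTop_nat 1)).const_mul _
  rw [mul_zero] at hlim
  refine eventually_of_eventually_succ ?_
  filter_upwards [hlim.eventually_lt_const hδ', eventually_ge_atTop m] with n h1 h2 h3
  have h4 := ENNReal.toReal_mono (measure_ne_top _ _) ((mul_le_mul' (mul_le_mul'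
    (min_le_left δ 1) le_rfl) le_rfl).trans (hle n h2 h3))
  refine le_trans ?_ h4
  rw [ENNReal.toReal_mul, ENNReal.toReal_mul, ENNReal.toReal_pow, ENNReal.toReal_inv,
    ENNReal.toReal_natCast, ENNReal.toReal_ofReal (Real.exp_pos _).le, ← Real.exp_nat_mul]
  change _ ≤ δ' * _ * _
  set N : ℝ := ((n + 1 : ℕ) : ℝ)
  have hN : 0 < N := by positivity
  have hP : (0 : ℝ) < 2 * ((N * K) ^ 2) ^ e := by positivity
  have hcast : ((2 * (((n + 1) * K) ^ 2) ^ e : ℕ) : ℝ) = 2 * ((N * K) ^ 2) ^ e := by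
    simp only [N]; push_cast; ring
  rw [hcast, ← div_eq_mul_inv, le_div_iff₀ hP]
  have h5 : 2 * ((N * K) ^ 2) ^ e = 2 * (K : ℝ) ^ (2 * e) * (N ^ (2 * e) /
      Real.exp (c / 2 * N)) * Real.exp (c / 2 * N) := by
    rw [← pow_mul, mul_pow]
    field_simp
  have h6 : Real.exp (-c * N) * Real.exp (c / 2 * N) ≤ Real.exp (n * -(c / 2)) := by
    rw [← Real.exp_add, Real.exp_le_exp]
    simp only [N]; push_cast
    nlinarith
  calc Real.exp (-c * N) * (2 * ((N * K) ^ 2) ^ e)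
      = 2 * (K : ℝ) ^ (2 * e) * (N ^ (2 * e) / Real.exp (c / 2 * N)) *
        (Real.exp (-c * N) * Real.exp (c / 2 * N)) := by rw [h5]; ring
    _ ≤ δ' * Real.exp (n * -(c / 2)) := by gcongr

end AcceptanceAsymptotics

/-! ### The first accepted run -/

section Output

theorem runsLaw_pi (F : PMF ℕ) (n : ℕ) (s : Finset ℕ) (A : ℕ → Set (Run n)) :
    runsLaw F n {ω | ∀ t ∈ s, ω t ∈ A t} = ∏ t ∈ s, (runLaw F n).toMeasure (A t) :=
  Measure.infinitePi_pi (fun _ => (runLaw F n).toMeasure) (t := A)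
    fun _ _ => MeasurableSpace.measurableSet_top

instance (F : PMF ℕ) (n : ℕ) : IsProbabilityMeasure (runsLaw F n) := by
  unfold runsLaw; infer_instance

theorem toMeasure_not_accepted_lt_one {F : PMF ℕ} {rule : ParityRule} {n : ℕ}
    (h : (runLaw F n).toMeasure {r | Accepted rule r} ≠ 0) :
    (runLaw F n).toMeasure {r | ¬ Accepted rule r} < 1 := by
  have h1 : (runLaw F n).toMeasure {r | ¬ Accepted rule r} =
      1 - (runLaw F n).toMeasure {r | Accepted rule r} := by
    rw [← prob_compl_eq_one_sub MeasurableSpace.measurableSet_top]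
    rfl
  rw [h1]
  exact ENNReal.sub_lt_self ENNReal.one_ne_top one_ne_zero h

/-- If acceptance has positive probability, the repeated model terminates almost surely. -/
theorem ae_exists_accepted {F : PMF ℕ} {rule : ParityRule} {n : ℕ}
    (h : (runLaw F n).toMeasure {r | Accepted rule r} ≠ 0) :
    ∀ᵐ ω ∂(runsLaw F n), ∃ t, Accepted rule (ω t) := by
  set ρ := (runLaw F n).toMeasure {r | ¬ Accepted rule r}
  have hρ : ρ < 1 := toMeasure_not_accepted_lt_one h
  rw [ae_iff]
  refine le_antisymm ?_ (zero_le)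
  refine ge_of_tendsto' (ENNReal.tendsto_pow_atTop_nhds_zero_of_lt_one hρ) fun T => ?_
  have h1 := runsLaw_pi F n (Finset.range T) fun _ => {r | ¬ Accepted rule r}
  rw [Finset.prod_const, Finset.card_range] at h1
  rw [← h1]
  refine measure_mono fun ω hω t _ => ?_
  exact fun ht => hω ⟨t, ht⟩

/-- The output is distributed like the graph of a run conditioned on acceptance; only this
inequality is needed. -/
theorem repeatedLaw_le {F : PMF ℕ} {rule : ParityRule} {n : ℕ}
    (h : (runLaw F n).toMeasure {r | Accepted rule r} ≠ 0) (S : Set (SimpleGraph (Fin n)))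
    (hS : MeasurableSet S) :
    repeatedLaw F rule n S ≤ (runLaw F n).toMeasure {r | Accepted rule r ∧ r.graph ∈ S} /
      (runLaw F n).toMeasure {r | Accepted rule r} := by
  classical
  set ρ := (runLaw F n).toMeasure {r | ¬ Accepted rule r}
  set B := (runLaw F n).toMeasure {r | Accepted rule r ∧ r.graph ∈ S}
  have hρ : 1 - ρ = (runLaw F n).toMeasure {r | Accepted rule r} := by
    rw [← prob_compl_eq_one_sub MeasurableSpace.measurableSet_top]
    congr 1
    ext r
    simp
  rw [repeatedLaw, Measure.map_apply (measurable_output rule) hS]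
  have hsub : output rule ⁻¹' S ⊆ {ω | ¬ ∃ t, Accepted rule (ω t)} ∪
      ⋃ t, {ω | ∀ s ∈ Finset.range (t + 1), ω s ∈
        if s = t then {r | Accepted rule r ∧ r.graph ∈ S} else {r | ¬ Accepted rule r}} := by
    intro ω hω
    by_cases hex : ∃ t, Accepted rule (ω t)
    · right
      simp only [Set.mem_preimage, output, dif_pos hex] at hω
      refine Set.mem_iUnion.2 ⟨Nat.find hex, fun s hs => ?_⟩
      split_ifs with hst
      · subst hst
        exact ⟨Nat.find_spec hex, hω⟩
      · exact Nat.find_min hex (lt_of_le_of_ne (Nat.lt_succ_iff.1 (Finset.mem_range.1 hs)) hst)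
    · exact Or.inl hex
  refine (measure_mono hsub).trans ((measure_union_le _ _).trans ?_)
  rw [show runsLaw F n {ω | ¬ ∃ t, Accepted rule (ω t)} = 0 from
    ae_iff.1 (ae_exists_accepted h), zero_add]
  refine (measure_iUnion_le _).trans ?_
  have hterm : ∀ t, runsLaw F n {ω | ∀ s ∈ Finset.range (t + 1), ω s ∈
        if s = t then {r | Accepted rule r ∧ r.graph ∈ S} else {r | ¬ Accepted rule r}} =
      ρ ^ t * B := by
    intro t
    have h1 := runsLaw_pi F n (Finset.range (t + 1)) fun s =>
      if s = t then {r | Accepted rule r ∧ r.graph ∈ S} else {r | ¬ Accepted rule r}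
    rw [h1, Finset.prod_range_succ, if_pos rfl]
    congr 1
    rw [Finset.prod_congr rfl (g := fun _ => ρ), Finset.prod_const, Finset.card_range]
    intro s hs
    rw [if_neg (Finset.mem_range.1 hs).ne]
  simp only [hterm]
  rw [ENNReal.tsum_mul_right, ENNReal.tsum_geometric, hρ, mul_comm, ENNReal.div_eq_inv_mul,
    mul_comm]

end Output

/-! ### The degrees of the graph of a simple run -/

section Degrees

open Classical in
theorem degree_graph_eq_card {n : ℕ} {r : Run n} (hr : r.IsSimple) (v : Fin n) :
    r.graph.degree v = (Finset.univ.filter fun t => v ∈ r.edge t).card := by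
  rw [← SimpleGraph.card_incidenceFinset_eq_degree,
    ← Finset.card_image_of_injective _ hr.2]
  congr 1
  ext e
  rw [SimpleGraph.mem_incidenceFinset, SimpleGraph.incidenceSet, Run.graph,
    SimpleGraph.edgeSet_fromEdgeSet]
  simp only [Finset.mem_image, Finset.mem_filter, Finset.mem_univ, true_and]
  constructor
  · rintro ⟨⟨⟨t, rfl⟩, -⟩, hv⟩
    exact ⟨t, hv, rfl⟩
  · rintro ⟨t, hv, rfl⟩
    exact ⟨⟨⟨t, rfl⟩, hr.1 t⟩, hv⟩

/-- Only the last position can be left over. -/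
theorem eq_of_notMem_range_ends {M : ℕ} {i : Fin M}
    (hi : i ∉ Set.range (Sum.elim (firstEnd M) (secondEnd M))) : (i : ℕ) + 1 = M := by
  by_contra hne
  have := i.2
  apply hi
  rcases Nat.even_or_odd' i with ⟨k, hk | hk⟩
  · exact ⟨Sum.inl ⟨k, by omega⟩, Fin.ext (by simp [firstEnd, hk])⟩
  · exact ⟨Sum.inr ⟨k, by omega⟩, Fin.ext (by simp [secondEnd, hk])⟩

open Classical in
theorem degree_graph_eq_stubs {n : ℕ} {r : Run n} (hr : r.IsSimple) {v : Fin n}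
    (hv : ∀ i ∉ Set.range (Sum.elim (firstEnd (∑ i, r.stubs i)) (secondEnd _)),
      (r.pick i).1 ≠ v) :
    r.graph.degree v = r.stubs v := by
  rw [degree_graph_eq_card hr, ← card_stub_filter_eq r.stubs v]
  have h1 : (Finset.univ.filter fun p : Stub r.stubs => p.1 = v) =
      (Finset.univ.filter fun x => (r.pick (Sum.elim (firstEnd _) (secondEnd _) x)).1 = v).map
        ⟨fun x => r.pick (Sum.elim (firstEnd _) (secondEnd _) x),
          r.pick.injective.comp (injective_ends _)⟩ := by
    ext p
    simp only [Finset.mem_filter, Finset.mem_univ, true_and, Finset.mem_map,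
      Function.Embedding.coeFn_mk]
    constructor
    · rintro hp
      obtain ⟨x, hx⟩ : r.pick.symm p ∈ Set.range (Sum.elim (firstEnd _) (secondEnd _)) := by
        by_contra hno
        exact hv _ hno (by simpa using hp)
      have hx' : r.pick (Sum.elim (firstEnd _) (secondEnd _) x) = p := by rw [hx]; simp
      exact ⟨x, by rw [hx', hp], hx'⟩
    · rintro ⟨x, hx, rfl⟩
      exact hx
  rw [h1, Finset.card_map, Finset.card_filter, Finset.card_filter, Fintype.sum_sum_type,
    ← Finset.sum_add_distrib]
  refine Finset.sum_congr rfl fun t _ => ?_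
  have hmem : v ∈ r.edge t ↔ (r.pick (firstEnd _ t)).1 = v ∨ (r.pick (secondEnd _ t)).1 = v := by
    simp only [Run.edge, Sym2.mem_iff, firstEnd, secondEnd, eq_comm]
  have hnd : (r.pick (firstEnd _ t)).1 ≠ (r.pick (secondEnd _ t)).1 := fun h => hr.1 t
    (Sym2.mk_isDiag_iff.2 h)
  simp only [Sum.elim_inl, Sum.elim_inr, hmem]
  by_cases ha : (r.pick (firstEnd _ t)).1 = v
  · have hb : (r.pick (secondEnd _ t)).1 ≠ v := fun h => hnd (ha.trans h.symm)
    simp [ha, hb]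
  · simp only [ha, false_or, if_false, zero_add]
    congr

/-- In a simple run, the degrees are the numbers of stubs, except possibly at one vertex. -/
theorem abs_numDegree_graph_sub_le {n : ℕ} {r : Run n} (hr : r.IsSimple) (j : ℕ) :
    |(numDegree j r.graph : ℝ) - (Finset.univ.filter fun i => r.stubs i = j).card| ≤ 1 := by
  classical
  set E : Finset (Fin n) := (Finset.univ.filter fun i =>
    i ∉ Set.range (Sum.elim (firstEnd (∑ i, r.stubs i)) (secondEnd _))).image
      fun i => (r.pick i).1
  have hE : E.card ≤ 1 := by
    refine Finset.card_image_le.trans (Finset.card_le_one.2 fun i hi k hk => Fin.ext ?_)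
    have h1 := eq_of_notMem_range_ends (Finset.mem_filter.1 hi).2
    have h2 := eq_of_notMem_range_ends (Finset.mem_filter.1 hk).2
    omega
  have hdeg : ∀ v ∉ E, r.graph.degree v = r.stubs v := fun v hv =>
    degree_graph_eq_stubs hr fun i hi h => hv (Finset.mem_image.2
      ⟨i, Finset.mem_filter.2 ⟨Finset.mem_univ i, hi⟩, h⟩)
  have h1 : numDegree j r.graph ≤ (Finset.univ.filter fun i => r.stubs i = j).card + 1 := by
    refine le_trans (Finset.card_le_card (t := (Finset.univ.filter fun i => r.stubs i = j) ∪ E)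
      fun v hv => ?_) ((Finset.card_union_le _ _).trans (Nat.add_le_add_left hE _))
    by_cases hvE : v ∈ E
    · exact Finset.mem_union_right _ hvE
    · refine Finset.mem_union_left _ (Finset.mem_filter.2 ⟨Finset.mem_univ v, ?_⟩)
      rw [← hdeg v hvE]
      convert (Finset.mem_filter.1 hv).2
  have h2 : (Finset.univ.filter fun i => r.stubs i = j).card ≤ numDegree j r.graph + 1 := by
    refine le_trans (Finset.card_le_card
      (t := (Finset.univ.filter fun v => r.graph.degree v = j) ∪ E)
      fun v hv => ?_) ((Finset.card_union_le _ _).trans (Nat.add_le_add (le_of_eq ?_) hE))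
    · by_cases hvE : v ∈ E
      · exact Finset.mem_union_right _ hvE
      · refine Finset.mem_union_left _ (Finset.mem_filter.2 ⟨Finset.mem_univ v, ?_⟩)
        rw [hdeg v hvE]
        exact (Finset.mem_filter.1 hv).2
    · rfl
  rw [abs_le]
  have h1' : (numDegree j r.graph : ℝ) ≤
    (Finset.univ.filter fun i => r.stubs i = j).card + 1 := by exact_mod_cast h1
  have h2' : ((Finset.univ.filter fun i => r.stubs i = j).card : ℝ) ≤
    numDegree j r.graph + 1 := by exact_mod_cast h2
  constructor <;> linarith

end Degrees

/-! ### Concentration of the numbers of stubs -/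

section Concentration

/-- Hoeffding's inequality for the number of vertices with `j` stubs. -/
theorem pi_abs_card_sub_le (F : PMF ℕ) (j n : ℕ) {ε : ℝ} (hε : 0 ≤ ε) :
    (Measure.pi fun _ : Fin n => F.toMeasure).real
      {d | n * ε ≤ |((Finset.univ.filter fun i => d i = j).card : ℝ) - n * (F j).toReal|} ≤
    2 * Real.exp (-(2 * ε ^ 2) * n) := by
  classical
  set μ := Measure.pi fun _ : Fin n => F.toMeasure
  set f : ℕ → ℝ := fun k => if k = j then 1 else 0
  have hf : ∫ k, f k ∂F.toMeasure = (F j).toReal := by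
    have : f = Set.indicator {j} 1 := by
      ext k
      simp [f, Set.indicator_apply]
    rw [this, integral_indicator_one (measurableSet_singleton j), Measure.real,
      PMF.toMeasure_apply_singleton _ _ (measurableSet_singleton j)]
  have hsub : HasSubgaussianMGF (fun k => f k - (F j).toReal) ((‖(1 : ℝ) - 0‖₊ / 2) ^ 2)
      F.toMeasure := by
    rw [← hf]
    refine hasSubgaussianMGF_of_mem_Icc (measurable_of_countable f).aemeasurable
      (ae_of_all _ fun k => ?_)
    simp only [f]
    split_ifs <;> simp
  have hX : ∀ i : Fin n, HasSubgaussianMGF (fun d : Fin n → ℕ => f (d i) - (F j).toReal)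
      ((‖(1 : ℝ) - 0‖₊ / 2) ^ 2) μ := fun i => by
    have hmp := measurePreserving_eval (fun _ : Fin n => F.toMeasure) i
    have := hmp.map_eq ▸ hsub
    exact HasSubgaussianMGF.of_map hmp.measurable.aemeasurable this
  have hind : iIndepFun (fun (i : Fin n) (d : Fin n → ℕ) => f (d i) - (F j).toReal) μ :=
    iIndepFun_pi (X := fun _ k => f k - (F j).toReal)
      fun _ => (measurable_of_countable _).aemeasurable
  have hind' : iIndepFun (fun (i : Fin n) (d : Fin n → ℕ) => -(f (d i) - (F j).toReal)) μ :=
    iIndepFun_pi (X := fun _ k => -(f k - (F j).toReal))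
      fun _ => (measurable_of_countable _).aemeasurable
  have hnε : 0 ≤ n * ε := by positivity
  have h1 := HasSubgaussianMGF.measure_sum_ge_le_of_iIndepFun hind (s := Finset.univ)
    (fun i _ => hX i) hnε
  have h2 := HasSubgaussianMGF.measure_sum_ge_le_of_iIndepFun hind' (s := Finset.univ)
    (fun i _ => (hX i).neg) hnε
  have hexp : -(n * ε) ^ 2 / (2 * ((∑ _i : Fin n, (‖(1 : ℝ) - 0‖₊ / 2) ^ 2 : NNReal) : ℝ)) =
      -(2 * ε ^ 2) * n := by
    rcases Nat.eq_zero_or_pos n with rfl | hn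
    · simp
    · have : (n : ℝ) ≠ 0 := by positivity
      simp
      field_simp
  rw [hexp] at h1 h2
  have hsum : ∀ d : Fin n → ℕ, ∑ i, (f (d i) - (F j).toReal) =
      ((Finset.univ.filter fun i => d i = j).card : ℝ) - n * (F j).toReal := by
    intro d
    simp [f, Finset.sum_sub_distrib, Finset.sum_boole]
  refine le_trans (measureReal_mono (fun d hd => ?_)) ((measureReal_union_le _ _).trans
    ((add_le_add h1 h2).trans_eq (two_mul _).symm))
  change n * ε ≤ |((Finset.univ.filter fun i => d i = j).card : ℝ) - n * (F j).toReal| at hd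
  rw [← hsum] at hd
  rcases le_abs.1 hd with h | h
  · exact Or.inl h
  · right
    change n * ε ≤ ∑ i, -(f (d i) - (F j).toReal)
    rwa [Finset.sum_neg_distrib]

theorem map_stubs_runLaw (F : PMF ℕ) (n : ℕ) : (runLaw F n).map Run.stubs = stubLaw F n := by
  rw [runLaw, PMF.map_bind]
  have : ∀ d : Fin n → ℕ, ((PMF.uniformOfFintype (PickOrder d)).map
      fun σ => Run.mk d σ).map Run.stubs = PMF.pure d := fun d => by
    rw [PMF.map_comp]
    exact PMF.map_const _ d
  simp [this]

theorem runLaw_abs_card_sub_le (F : PMF ℕ) (j n : ℕ) {ε : ℝ} (hε : 0 ≤ ε) :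
    (runLaw F n).toMeasure.real
      {r | n * ε ≤ |((Finset.univ.filter fun i => r.stubs i = j).card : ℝ) - n * (F j).toReal|} ≤
    2 * Real.exp (-(2 * ε ^ 2) * n) := by
  refine le_trans (le_of_eq ?_) (pi_abs_card_sub_le F j n hε)
  have h : (Measure.pi fun _ : Fin n => F.toMeasure) =
      (runLaw F n).toMeasure.map Run.stubs := by
    rw [PMF.toMeasure_map _ _ measurable_from_top, map_stubs_runLaw, stubLaw,
      Measure.toPMF_toMeasure]
  rw [h, map_measureReal_apply measurable_from_top MeasurableSet.of_discrete]
  rfl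

end Concentration

/-! ### Convergence of the degree distributions -/

section Convergence

instance (n : ℕ) : MeasurableSingletonClass (SimpleGraph (Fin n)) where
  measurableSet_singleton G := by
    convert SimpleGraph.measurable_adj (V := Fin n) (measurableSet_singleton G.Adj)
    ext H
    simp

instance (F : PMF ℕ) (rule : ParityRule) (n : ℕ) : IsProbabilityMeasure (repeatedLaw F rule n) :=
  Measure.isProbabilityMeasure_map (measurable_output rule).aemeasurable

/-- Conditioning on acceptance costs a factor `1 / P(accepted)`, and an atypical empirical degree
distribution of the output requires atypical numbers of stubs. -/
theorem repeatedLaw_real_le {F : PMF ℕ} {rule : ParityRule} {n : ℕ} (j : ℕ) {ε c : ℝ}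
    (hε : 0 < ε) (hn : 1 ≤ n * (ε / 2))
    (hacc : Real.exp (-c * n) ≤ (runLaw F n).toMeasure.real {r | Accepted rule r}) :
    (repeatedLaw F rule n).real {G | ε < |(numDegree j G : ℝ) / n - (F j).toReal|} ≤
      2 * Real.exp (-(ε ^ 2 / 2 - c) * n) := by
  have hpos : 0 < (runLaw F n).toMeasure.real {r | Accepted rule r} :=
    (Real.exp_pos _).trans_le hacc
  have hne : (runLaw F n).toMeasure {r | Accepted rule r} ≠ 0 := fun h => by
    simp [Measure.real, h] at hpos
  have hn0 : (0 : ℝ) < n := by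
    by_contra h
    have := mul_nonpos_of_nonpos_of_nonneg (not_lt.1 h) (half_pos hε).le
    linarith
  set S := {G : SimpleGraph (Fin n) | ε < |(numDegree j G : ℝ) / n - (F j).toReal|}
  have h1 : (repeatedLaw F rule n).real S ≤
      (runLaw F n).toMeasure.real {r | Accepted rule r ∧ r.graph ∈ S} /
        (runLaw F n).toMeasure.real {r | Accepted rule r} := by
    have := ENNReal.toReal_mono (ENNReal.div_ne_top (measure_ne_top _ _) hne)
      (repeatedLaw_le hne S (Set.toFinite S).measurableSet)
    rwa [ENNReal.toReal_div] at this
  have h2 : (runLaw F n).toMeasure.real {r | Accepted rule r ∧ r.graph ∈ S} ≤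
      2 * Real.exp (-(2 * (ε / 2) ^ 2) * n) := by
    refine le_trans (measureReal_mono ?_) (runLaw_abs_card_sub_le F j n (half_pos hε).le)
    rintro r ⟨hr, hS⟩
    have hs : r.IsSimple := by
      cases rule with
      | removeStub => exact hr
      | regenerate => exact hr.2
    have h3 := abs_numDegree_graph_sub_le hs j
    have h4 : n * ε < |(numDegree j r.graph : ℝ) - n * (F j).toReal| := by
      change ε < |(numDegree j r.graph : ℝ) / n - (F j).toReal| at hS
      have h5 : (numDegree j r.graph : ℝ) - n * (F j).toReal =
          n * ((numDegree j r.graph : ℝ) / n - (F j).toReal) := by field_simp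
      rw [h5, abs_mul, abs_of_pos hn0]
      exact mul_lt_mul_of_pos_left hS hn0
    have h5 := abs_sub_le (numDegree j r.graph : ℝ)
      ((Finset.univ.filter fun i => r.stubs i = j).card : ℝ) (n * (F j).toReal)
    change n * (ε / 2) ≤ _
    linarith
  calc (repeatedLaw F rule n).real S
      ≤ 2 * Real.exp (-(2 * (ε / 2) ^ 2) * n) / Real.exp (-c * n) := by
        refine h1.trans ?_
        gcongr
    _ = _ := by
        rw [mul_div_assoc, ← Real.exp_sub]
        ring_nf

theorem tendsto_repeatedLaw_real (F : PMF ℕ) (rule : ParityRule) (j : ℕ) {ε : ℝ} (hε : 0 < ε) :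
    Tendsto (fun n : ℕ => (repeatedLaw F rule n).real
        {G | ε < |(numDegree j G : ℝ) / n - (F j).toReal|})
      (atTop ⊓ 𝓟 (admissible F rule)) (𝓝 0) := by
  have hlim : Tendsto (fun n : ℕ => 2 * Real.exp (-(ε ^ 2 / 2 - ε ^ 2 / 4) * n)) atTop (𝓝 0) := by
    rw [← mul_zero (2 : ℝ)]
    refine (Real.tendsto_exp_atBot.comp ?_).const_mul 2
    exact tendsto_natCast_atTop_atTop.const_mul_atTop_of_neg (by nlinarith [sq_pos_of_pos hε])
  refine tendsto_of_tendsto_of_tendsto_of_le_of_le' tendsto_const_nhds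
    (hlim.mono_left inf_le_left) (Eventually.of_forall fun n => measureReal_nonneg) ?_
  have hlarge : ∀ᶠ n : ℕ in atTop, 1 ≤ (n : ℝ) * (ε / 2) :=
    (tendsto_natCast_atTop_atTop.atTop_mul_const (half_pos hε)).eventually_ge_atTop 1
  -- any rate below the exponent `ε ^ 2 / 2` of the concentration bound will do
  filter_upwards [eventually_exp_le_runLaw_accepted F rule (c := ε ^ 2 / 4) (by positivity),
    hlarge.filter_mono inf_le_left] with n h1 h2
  exact repeatedLaw_real_le j hε h2 h1

open Classical in
theorem degreeProb_eq_integral {n : ℕ} (μ : Measure (SimpleGraph (Fin n))) [IsProbabilityMeasure μ]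
    (k : ℕ) : degreeProb μ k = ∫ G, (numDegree k G : ℝ) / n ∂μ := by
  have h : ∀ G : SimpleGraph (Fin n), uniformOn (Set.univ : Set (Fin n))
      (Prod.mk G ⁻¹' {x : SimpleGraph (Fin n) × Fin n | x.1.degree x.2 = k}) =
      (numDegree k G : ENNReal) / n := by
    intro G
    rw [uniformOn_univ, Fintype.card_fin]
    congr 1
    rw [numDegree, ← Measure.count_apply_finset]
    congr 1
    ext v
    simp
  rw [degreeProb, Measure.real, Measure.prod_apply (Set.toFinite _).measurableSet,
    ← integral_toReal Measurable.of_discrete.aemeasurable (ae_of_all _ fun G => measure_lt_top _ _)]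
  refine integral_congr_ae (ae_of_all _ fun G => ?_)
  simp only [h G, ENNReal.toReal_div, ENNReal.toReal_natCast]

/-- The expectation of a variable with values in `[0, 1]` is close to `p` if the variable is close
to `p` with high probability. -/
theorem abs_degreeProb_sub_le {n : ℕ} (μ : Measure (SimpleGraph (Fin n))) [IsProbabilityMeasure μ]
    (k : ℕ) {p ε : ℝ} (hp : p ∈ Set.Icc (0 : ℝ) 1) (hε : 0 ≤ ε) :
    |degreeProb μ k - p| ≤ ε + μ.real {G | ε < |(numDegree k G : ℝ) / n - p|} := by
  classical
  set S := {G : SimpleGraph (Fin n) | ε < |(numDegree k G : ℝ) / n - p|}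
  have hint : ∀ f : SimpleGraph (Fin n) → ℝ, Integrable f μ := fun f => Integrable.of_finite
  have h1 : degreeProb μ k - p = ∫ G, ((numDegree k G : ℝ) / n - p) ∂μ := by
    rw [degreeProb_eq_integral, integral_sub (hint _) (hint _)]
    simp
  have h2 : ε + μ.real S = ∫ G, (ε + S.indicator 1 G) ∂μ := by
    rw [integral_add (hint _) (hint _), integral_indicator_one (Set.toFinite S).measurableSet]
    simp
  rw [h1, h2]
  refine (abs_integral_le_integral_abs).trans (integral_mono (hint _) (hint _) fun G => ?_)
  have hle : (numDegree k G : ℝ) / n ≤ 1 := by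
    refine div_le_one_of_le₀ ?_ (Nat.cast_nonneg n)
    have : numDegree k G ≤ n := (Finset.card_le_univ _).trans_eq (Fintype.card_fin n)
    exact_mod_cast this
  have hge : 0 ≤ (numDegree k G : ℝ) / n := by positivity
  by_cases hG : G ∈ S
  · simp only [Set.indicator_of_mem hG, Pi.one_apply]
    have : |(numDegree k G : ℝ) / n - p| ≤ 1 := abs_le.2 ⟨by linarith [hp.2], by linarith [hp.1]⟩
    linarith
  · simp only [Set.indicator_of_notMem hG, add_zero]
    exact not_lt.1 hG

theorem tendsto_degreeProb (F : PMF ℕ) (rule : ParityRule) (k : ℕ) :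
    Tendsto (fun n : ℕ => degreeProb (repeatedLaw F rule n) k)
      (atTop ⊓ 𝓟 (admissible F rule)) (𝓝 (F k).toReal) := by
  have hp : (F k).toReal ∈ Set.Icc (0 : ℝ) 1 :=
    ⟨ENNReal.toReal_nonneg, ENNReal.toReal_mono ENNReal.one_ne_top (F.coe_le_one k)⟩
  rw [Metric.tendsto_nhds]
  intro ε hε
  filter_upwards [(tendsto_repeatedLaw_real F rule k (half_pos hε)).eventually_lt_const
    (half_pos hε)] with n hn
  rw [Real.dist_eq]
  linarith [abs_degreeProb_sub_le (repeatedLaw F rule n) k hp (half_pos hε).le]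

end Convergence

end ConfigModel

theorem mainTheorem7 (F : PMF ℕ)
    (hF : Summable fun k : ℕ => (k : ℝ) ^ 2 * (F k).toReal)
    (rule : ConfigModel.ParityRule) :
    (∀ᶠ n in atTop ⊓ 𝓟 (ConfigModel.admissible F rule),
      ∀ᵐ ω ∂(ConfigModel.runsLaw F n), ∃ t, ConfigModel.Accepted rule (ω t)) ∧
    (∀ k : ℕ, Tendsto
      (fun n : ℕ => ConfigModel.degreeProb (ConfigModel.repeatedLaw F rule n) k)
      (atTop ⊓ 𝓟 (ConfigModel.admissible F rule)) (𝓝 (F k).toReal)) ∧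
    (∀ j : ℕ, ∀ ε : ℝ, 0 < ε → Tendsto
      (fun n : ℕ => (ConfigModel.repeatedLaw F rule n).real
        {G | ε < |(ConfigModel.numDegree j G : ℝ) / n - (F j).toReal|})
      (atTop ⊓ 𝓟 (ConfigModel.admissible F rule)) (𝓝 0)) := by
  refine ⟨?_, ConfigModel.tendsto_degreeProb F rule,
    fun j _ hε => ConfigModel.tendsto_repeatedLaw_real F rule j hε⟩
  filter_upwards [ConfigModel.eventually_exp_le_runLaw_accepted F rule one_pos] with n hn
  refine ConfigModel.ae_exists_accepted fun h => ?_
  rw [Measure.real, h] at hn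
  exact absurd hn (not_le.2 (Real.exp_pos _))
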